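/- **Setting.** There are $N$ players and $K\ge N$ arms. Each arm $a$ has a known strict preference list over the players. If player $p$ is matched with arm $a$, it receives a reward in $[0,1]$ with unknown law $\mathbb P_{p,a}$ and mean $\mu_{p,a}$; the rewards of a pair in different rounds are independent. For each $p$ the means $\mu_{p,a}$ are pairwise distinct, and $p$ truly prefers arms with larger mean. Let $m^\star_s$ be the player-optimal stable matching for these preferences. **Elimination Algorithm** (input $\delta>0$). Start with $S_p=$ all arms, for every player $p$. In round $t=1,2,\dots$, as long as some $S_p\neq\emptyset$: sample all matchings of a minimal matching cover of $\{(p,a): a\in S_p\}$ (a set of matchings of minimal cardinality covering all these pairs, each exactly once); update the sample means $\hat\mu_{p,a}$, $a\in S_p$; let $\epsilon_t=\sqrt{\ln(4KNt^2/\delta)/(2t)}$ and $C_{p,a}=[\hat\mu_{p,a}-\epsilon_t,\hat\mu_{p,a}+\epsilon_t]$; simultaneously remove from $S_p$ every $a\in S_p$ with $C_{p,a}\cap C_{p,j}=\emptyset$ for all other available arms $j\in S_p\setminus\{a\}$. When all $S_p$ are empty, sort the arms for each player by decreasing $\hat\mu_{p,a}$, and return the result of player-proposing deferred acceptance with these estimated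 preferences and the true preferences of the arms. **Theorem.** The algorithm is $\delta$-PCOS: with probability at least $1-\delta$ it terminates and outputs $m^\star_s$. Let $K\ge 2$ and put, for each pair $(p,a)$, $$\Delta_{p,a}=\min_{a'\ne a}|\mu_{p,a}-\mu_{p,a'}|,\qquad t_{p,a}=\frac{\ln\big(KN/(\delta\,\Delta_{p,a})\big)}{\Delta_{p,a}^2}.$$ For a set $S$ of pairs let $\Delta(G(S))$ be the maximum degree of the bipartite graph with edge set $S$, and let $\mathcal P(S)=\{r\subseteq S:\Delta(G(S))-\Delta(G(S\setminus r))=1\}$. With $S$ the set of all pairs, choose successively, for $i=1,\dots,K$, $$r_i\in\arg\min_{r\in\mathcal P(S\setminus\bigcup_{j<i}r_j)}\ \max_{(p,a)\in r}t_{p,a},$$ where pairs with equal $t_{p,a}$ are compared by an arbitrary strict linear order on the pairs that is fixed in advance. There is a universal constant $C$ (independent of $N$, $K$, $\delta$, the reward laws and the preferences) such that with probability at least $1-\delta$ the algorithm terminates, outputs $m^\star_s$, and has sampled at most $$C\sum_{s=1}^{K}\max_{(p,a)\in r_s}t_{p,a}$$ matchings in total. -/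

import Mathlib

open MeasureTheory ProbabilityTheory

/-! ### Two-sided markets

Players are `Fin N`, arms are `Fin K`.  A preference list over `n` agents is a permutation `π` of
`Fin n`; `π i` is the agent in position `i` (position `0` is the favourite). -/

/-- A (player, arm) pair. -/
abbrev MarketPair (N K : ℕ) := Fin N × Fin K

/-- `Prefers π x y`: the agent with preference list `π` strictly prefers `x` to `y`. -/
def Prefers {n : ℕ} (π : Equiv.Perm (Fin n)) (x y : Fin n) : Prop := π.symm x < π.symm y

instance {n : ℕ} (π : Equiv.Perm (Fin n)) (x y : Fin n) : Decidable (Prefers π x y) :=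
  inferInstanceAs (Decidable (π.symm x < π.symm y))

/-- A matching: a set of pairwise disjoint player-arm pairs. -/
def IsMatching {N K : ℕ} (m : Finset (MarketPair N K)) : Prop :=
  ∀ x ∈ m, ∀ y ∈ m, x ≠ y → x.1 ≠ y.1 ∧ x.2 ≠ y.2

/-- `(p, a)` is a blocking pair of `m`: it is not in `m`, `p` is unmatched or prefers `a` to its
partner, and `a` is unmatched or prefers `p` to its partner. -/
def IsBlockingPair {N K : ℕ} (π : Fin N → Equiv.Perm (Fin K)) (ρ : Fin K → Equiv.Perm (Fin N))
    (m : Finset (MarketPair N K)) (p : Fin N) (a : Fin K) : Prop :=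
  (p, a) ∉ m ∧ (∀ b, (p, b) ∈ m → Prefers (π p) a b) ∧ (∀ q, (q, a) ∈ m → Prefers (ρ a) p q)

/-- Stable matchings. -/
def IsStable {N K : ℕ} (π : Fin N → Equiv.Perm (Fin K)) (ρ : Fin K → Equiv.Perm (Fin N))
    (m : Finset (MarketPair N K)) : Prop :=
  IsMatching m ∧ ∀ p a, ¬ IsBlockingPair π ρ m p a

/-- `m` is the player-optimal stable matching: it is stable, and each player is matched in `m` at
least as well as in any other stable matching. -/
def IsPlayerOptimalStable {N K : ℕ} (π : Fin N → Equiv.Perm (Fin K))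
    (ρ : Fin K → Equiv.Perm (Fin N)) (m : Finset (MarketPair N K)) : Prop :=
  IsStable π ρ m ∧
    ∀ m', IsStable π ρ m' → ∀ p a', (p, a') ∈ m' → ∃ a, (p, a) ∈ m ∧ (a = a' ∨ Prefers (π p) a a')

/-! ### The deferred acceptance algorithm (players propose) -/

/-- Given the set `R` of rejections so far, each player proposes to its favourite arm among those
that have not rejected it. -/
def daProposals {N K : ℕ} (π : Fin N → Equiv.Perm (Fin K)) (R : Finset (MarketPair N K)) :
    Finset (MarketPair N K) :=
  Finset.univ.filter fun x => x ∉ R ∧ ∀ b, Prefers (π x.1) b x.2 → (x.1, b) ∈ R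

/-- Each arm keeps its favourite proposer and rejects the others. -/
def daStep {N K : ℕ} (π : Fin N → Equiv.Perm (Fin K)) (ρ : Fin K → Equiv.Perm (Fin N))
    (R : Finset (MarketPair N K)) : Finset (MarketPair N K) :=
  R ∪ (daProposals π R).filter fun x => ∃ q, (q, x.2) ∈ daProposals π R ∧ Prefers (ρ x.2) q x.1

/-- Deferred acceptance.  Each step that is not the last one adds a rejection, so that `N * K`
steps suffice; the proposals then held form the output. -/
def deferredAcceptance {N K : ℕ} (π : Fin N → Equiv.Perm (Fin K))
    (ρ : Fin K → Equiv.Perm (Fin N)) : Finset (MarketPair N K) :=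
  daProposals π ((daStep π ρ)^[N * K] ∅)

/-- The preference list that sorts the arms by decreasing value (equal values by index). -/
noncomputable def argsortDesc {K : ℕ} (v : Fin K → ℝ) : Equiv.Perm (Fin K) :=
  Tuple.sort fun a => -v a

/-! ### Matching covers and degrees -/

/-- `M` is a set of matchings that together contain all pairs of `X`. -/
def IsMatchingCover {N K : ℕ} (X : Finset (MarketPair N K))
    (M : Finset (Finset (MarketPair N K))) : Prop :=
  (∀ m ∈ M, IsMatching m) ∧ ∀ x ∈ X, ∃ m ∈ M, x ∈ m

/-- A matching cover of `X` of minimal cardinality which contains each pair of `X` exactly once. -/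
def IsMinimalMatchingCover {N K : ℕ} (X : Finset (MarketPair N K))
    (M : Finset (Finset (MarketPair N K))) : Prop :=
  IsMatchingCover X M ∧ (∀ M', IsMatchingCover X M' → M.card ≤ M'.card) ∧
    ∀ x ∈ X, ∃! m, m ∈ M ∧ x ∈ m

/-- The maximum degree of the bipartite graph on players and arms whose edges are the pairs
in `S`. -/
def maxDegree {N K : ℕ} (S : Finset (MarketPair N K)) : ℕ :=
  max (Finset.univ.sup fun p : Fin N => (S.filter fun x => x.1 = p).card)
    (Finset.univ.sup fun a : Fin K => (S.filter fun x => x.2 = a).card)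

/-- The subsets `r` of `S` whose removal lowers the maximum degree by exactly one. -/
def degreeReducingSets {N K : ℕ} (S : Finset (MarketPair N K)) :
    Set (Finset (MarketPair N K)) :=
  {r | r ⊆ S ∧ maxDegree S = maxDegree (S \ r) + 1}

/-- The pairs that are left after removal of all `r j` with `j < i`. -/
def remainingPairs {N K : ℕ} (r : Fin K → Finset (MarketPair N K)) (i : Fin K) :
    Finset (MarketPair N K) :=
  Finset.univ \ (Finset.univ.filter (· < i)).biUnion r

/-- `r` is a sequence of successive degree-reducing sets: each `r i` minimizes the maximum of `t`
over its elements among all degree-reducing sets of the remaining pairs.  Pairs with equal values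
of `t` are compared by `tie`, i.e. pairs are ordered lexicographically by `(t, tie)`; the last
condition says that the largest pair of `r i` is at most the largest pair of `r'`. -/
def IsDegreeReducingSequence {N K : ℕ} (t : MarketPair N K → ℝ) (tie : MarketPair N K → ℕ)
    (r : Fin K → Finset (MarketPair N K)) : Prop :=
  ∀ i, r i ∈ degreeReducingSets (remainingPairs r i) ∧
    ∀ r' ∈ degreeReducingSets (remainingPairs r i),
      ∃ y ∈ r', ∀ x ∈ r i, toLex (t x, tie x) ≤ toLex (t y, tie y)

/-! ### The elimination algorithm -/

/-- State of the algorithm: the available pairs `{(p, a) | a ∈ S_p}`, the sum and the number of the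
rewards that each player has observed from each arm, and the number of matchings sampled. -/
structure ElimState (N K : ℕ) where
  active : Finset (MarketPair N K)
  rewardSum : Fin N → Fin K → ℝ
  numSamples : Fin N → Fin K → ℕ
  numMatchings : ℕ

/-- Sample means (`0` for a pair without samples). -/
noncomputable def ElimState.estimate {N K : ℕ} (s : ElimState N K) (p : Fin N) (a : Fin K) : ℝ :=
  s.rewardSum p a / s.numSamples p a

/-- The confidence radius of round `t = 1, 2, …`. -/
noncomputable def confRadius (N K : ℕ) (δ : ℝ) (t : ℕ) : ℝ :=
  Real.sqrt (Real.log (4 * K * N * (t : ℝ) ^ 2 / δ) / (2 * t))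

/-- All pairs are available at the start. -/
def elimInit (N K : ℕ) : ElimState N K where
  active := Finset.univ
  rewardSum := fun _ _ => 0
  numSamples := fun _ _ => 0
  numMatchings := 0

/-- Sampling in one round: all matchings of the cover `M` of the available pairs are sampled, and
each available pair, which lies in exactly one of them, gets one new reward `x p a`. -/
noncomputable def elimSample {N K : ℕ} (M : Finset (Finset (MarketPair N K)))
    (x : Fin N → Fin K → ℝ) (s : ElimState N K) : ElimState N K where
  active := s.active
  rewardSum := fun p a => if (p, a) ∈ s.active then s.rewardSum p a + x p a else s.rewardSum p a
  numSamples := fun p a => if (p, a) ∈ s.active then s.numSamples p a + 1 else s.numSamples p a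
  numMatchings := s.numMatchings + M.card

/-- The confidence interval of a pair, given the confidence radius `ε`. -/
noncomputable def ElimState.confInterval {N K : ℕ} (s : ElimState N K) (ε : ℝ) (p : Fin N)
    (a : Fin K) : Set ℝ :=
  Set.Icc (s.estimate p a - ε) (s.estimate p a + ε)

open Classical in
/-- Elimination in one round: simultaneously, every available pair `(p, a)` is removed whose
confidence interval meets that of no other available arm of `p`. -/
noncomputable def elimRemove {N K : ℕ} (ε : ℝ) (s : ElimState N K) : ElimState N K :=
  { s with
    active := s.active.filter fun x =>
      ¬ ∀ j, j ≠ x.2 → (x.1, j) ∈ s.active →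
        s.confInterval ε x.1 x.2 ∩ s.confInterval ε x.1 j = ∅ }

/-- The state after `t` rounds, for the confidence parameter `δ`, the rule `cover` that chooses the
matching cover, and the rewards `x`, where `x t p a` is the reward that player `p` receives from
arm `a` in round `t` if the pair is then sampled.  Nothing changes once no pair is available. -/
noncomputable def elimRun {N K : ℕ} (δ : ℝ)
    (cover : Finset (MarketPair N K) → Finset (Finset (MarketPair N K)))
    (x : ℕ → Fin N → Fin K → ℝ) : ℕ → ElimState N K
  | 0 => elimInit N K
  | t + 1 =>
    let s := elimRun δ cover x t
    if s.active = ∅ then s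
    else elimRemove (confRadius N K δ (t + 1)) (elimSample (cover s.active) (x (t + 1)) s)

/-- The matching returned: deferred acceptance on the estimated preferences. -/
noncomputable def ElimState.output {N K : ℕ} (ρ : Fin K → Equiv.Perm (Fin N))
    (s : ElimState N K) : Finset (MarketPair N K) :=
  deferredAcceptance (fun p => argsortDesc (s.estimate p)) ρ

/-! ### Rewards, gaps and the sample bound of a pair -/

/-- Player `p` receives from arm `a` rewards with law `D p a`, supported in `[0, 1]`; the rewards
of the same pair in different rounds are independent. -/
structure IsRewardProcess {N K : ℕ} {Ω : Type*} [MeasurableSpace Ω] (μ : Measure Ω)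
    (D : Fin N → Fin K → Measure ℝ) (X : ℕ → Fin N → Fin K → Ω → ℝ) : Prop where
  support : ∀ p a, ∀ᵐ x ∂(D p a), x ∈ Set.Icc (0 : ℝ) 1
  measurable : ∀ t p a, Measurable (X t p a)
  law : ∀ t p a, μ.map (X t p a) = D p a
  indep : ∀ p a, iIndepFun (fun t => X t p a) μ

/-- Expected reward of player `p` from arm `a`. -/
noncomputable def meanReward {N K : ℕ} (D : Fin N → Fin K → Measure ℝ) (p : Fin N) (a : Fin K) :
    ℝ :=
  ∫ x, x ∂(D p a)

/-- `Δ_{p,a}`, the smallest difference between the expected reward of `p` from `a` and from another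
arm. -/
noncomputable def minGap {N K : ℕ} (v : Fin N → Fin K → ℝ) (x : MarketPair N K) : ℝ :=
  ⨅ b : {b : Fin K // b ≠ x.2}, |v x.1 x.2 - v x.1 b|

/-- `t_{p,a} = ln (K N / (δ Δ_{p,a})) / Δ_{p,a} ^ 2`. -/
noncomputable def sampleBound {N K : ℕ} (δ : ℝ) (v : Fin N → Fin K → ℝ) (x : MarketPair N K) : ℝ :=
  Real.log (K * N / (δ * minGap v x)) / minGap v x ^ 2

/-! ### Maximum degrees and matching covers -/

/-! Everything happens on the event `AveragesAccurate`: in every round, the average of every pair is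
within the confidence radius of its mean. The table of rewards is defined for all rounds and pairs,
sampled or not, so the random elimination times play no role and no independence between pairs is
needed. Hoeffding's inequality and a union bound give this event probability at least 1 - δ
(`measure_not_averagesAccurate_le`); the rest is deterministic.

Correctness: when an arm is removed, its interval is disjoint from those of all arms still
available, so its estimate is already in the true order relative to them. Since the radii decrease,
later samples cannot undo this (`estimate_lt_estimate`). The final estimates thus sort the arms
exactly as the means do, and deferred acceptance on the true preferences yields the player-optimal
stable matching.

Cost: a pair is gone once four radii fit below its gap, which holds from round 256 t_{p,a} on. By
König's edge colouring theorem, a round costs at most the maximum degree of the available pairs. The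
greedy sets r_i have nondecreasing maxima, for otherwise an exchange would improve an earlier one
(`exists_le_succ`). Hence the pairs with t_{p,a} > θ all survive the removal of the sets with
maximum at most θ, and their degree is at most the number of remaining sets (`maxDegree_le_card`).
Summing over θ = n / 256 counts each r_i about 256 max t times. -/

theorem maxDegree_le_iff {N K : ℕ} {S : Finset (MarketPair N K)} {d : ℕ} :
    maxDegree S ≤ d ↔ (∀ p, (S.filter fun x => x.1 = p).card ≤ d) ∧
      ∀ a, (S.filter fun x => x.2 = a).card ≤ d := by
  simp [maxDegree]

theorem maxDegree_mono {N K : ℕ} {S T : Finset (MarketPair N K)} (h : S ⊆ T) :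
    maxDegree S ≤ maxDegree T := by
  have hT := maxDegree_le_iff.1 (le_refl (maxDegree T))
  exact maxDegree_le_iff.2
    ⟨fun p => (Finset.card_le_card (Finset.filter_subset_filter _ h)).trans (hT.1 p),
      fun a => (Finset.card_le_card (Finset.filter_subset_filter _ h)).trans (hT.2 a)⟩

theorem maxDegree_empty {N K : ℕ} : maxDegree (∅ : Finset (MarketPair N K)) = 0 := by
  simp [maxDegree]

theorem maxDegree_insert_le {N K : ℕ} (x : MarketPair N K) (S : Finset (MarketPair N K)) :
    maxDegree (insert x S) ≤ maxDegree S + 1 := by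
  have hS := maxDegree_le_iff.1 (le_refl (maxDegree S))
  have key (P : MarketPair N K → Prop) [DecidablePred P] :
      ((insert x S).filter P).card ≤ (S.filter P).card + 1 := by
    rw [Finset.filter_insert]
    split_ifs
    · exact Finset.card_insert_le _ _
    · exact Nat.le_succ _
  exact maxDegree_le_iff.2
    ⟨fun p => (key _).trans (Nat.succ_le_succ (hS.1 p)),
      fun a => (key _).trans (Nat.succ_le_succ (hS.2 a))⟩

theorem eq_empty_of_maxDegree_eq_zero {N K : ℕ} {S : Finset (MarketPair N K)}
    (h : maxDegree S = 0) : S = ∅ := by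
  rw [Finset.eq_empty_iff_forall_notMem]
  intro x hx
  have h1 := (maxDegree_le_iff.1 h.le).1 x.1
  have h2 : x ∈ S.filter fun y => y.1 = x.1 := by simp [hx]
  rw [Nat.le_zero, Finset.card_eq_zero] at h1
  simp [h1] at h2

/-- Players have degree K and arms degree N ≤ K. This is why exactly K degree-reducing sets exhaust
the pairs. -/
theorem maxDegree_univ {N K : ℕ} (hN : 1 ≤ N) (hNK : N ≤ K) :
    maxDegree (Finset.univ : Finset (MarketPair N K)) = K := by
  have h1 (p : Fin N) :
      ((Finset.univ : Finset (MarketPair N K)).filter fun x => x.1 = p).card = K := by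
    have : ((Finset.univ : Finset (MarketPair N K)).filter fun x => x.1 = p)
        = {p} ×ˢ Finset.univ := by ext ⟨q, b⟩; simp [eq_comm]
    simp [this]
  have h2 (a : Fin K) :
      ((Finset.univ : Finset (MarketPair N K)).filter fun x => x.2 = a).card = N := by
    have : ((Finset.univ : Finset (MarketPair N K)).filter fun x => x.2 = a)
        = Finset.univ ×ˢ {a} := by ext ⟨q, b⟩; simp [eq_comm]
    simp [this]
  refine le_antisymm (maxDegree_le_iff.2 ⟨fun p => (h1 p).le, fun a => (h2 a).le.trans hNK⟩) ?_
  exact (h1 ⟨0, hN⟩).symm.le.trans ((maxDegree_le_iff.1 le_rfl).1 _)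

/-! ### König's edge colouring theorem, from Birkhoff's theorem. -/

/-- The symmetric doubly stochastic matrix on players and arms attached to a set of pairs `S` and
a bound `d` on the degrees: pairs get the weight `1 / d`, and the rest is put on the diagonal. -/
noncomputable def degreeMatrix {N K : ℕ} (S : Finset (MarketPair N K)) (d : ℕ) :
    Matrix (Fin N ⊕ Fin K) (Fin N ⊕ Fin K) ℝ
  | .inl p, .inl q => if p = q then 1 - (S.filter fun x => x.1 = p).card / d else 0
  | .inl p, .inr a => if (p, a) ∈ S then 1 / d else 0
  | .inr a, .inl p => if (p, a) ∈ S then 1 / d else 0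
  | .inr a, .inr b => if a = b then 1 - (S.filter fun x => x.2 = a).card / d else 0

theorem degreeMatrix_symm {N K : ℕ} (S : Finset (MarketPair N K)) (d : ℕ)
    (i j : Fin N ⊕ Fin K) : degreeMatrix S d i j = degreeMatrix S d j i := by
  rcases i with p | a <;> rcases j with q | b
  · by_cases h : p = q
    · rw [h]
    · simp [degreeMatrix, h, Ne.symm h]
  · rfl
  · rfl
  · by_cases h : a = b
    · rw [h]
    · simp [degreeMatrix, h, Ne.symm h]

theorem card_filter_fst_eq {N K : ℕ} (S : Finset (MarketPair N K)) (p : Fin N) :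
    (S.filter fun x => x.1 = p).card = (Finset.univ.filter fun a => (p, a) ∈ S).card := by
  refine (Finset.card_bij (fun a _ => (p, a)) ?_ ?_ ?_).symm
  · simp
  · simp
  · rintro ⟨q, b⟩ h
    simp only [Finset.mem_filter] at h
    obtain ⟨h, rfl⟩ := h
    exact ⟨b, by simpa using h, rfl⟩

theorem card_filter_snd_eq {N K : ℕ} (S : Finset (MarketPair N K)) (a : Fin K) :
    (S.filter fun x => x.2 = a).card = (Finset.univ.filter fun p => (p, a) ∈ S).card := by
  refine (Finset.card_bij (fun p _ => (p, a)) ?_ ?_ ?_).symm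
  · simp
  · simp
  · rintro ⟨q, b⟩ h
    simp only [Finset.mem_filter] at h
    obtain ⟨h, rfl⟩ := h
    exact ⟨q, by simpa using h, rfl⟩

theorem degreeMatrix_mem_doublyStochastic {N K : ℕ} {S : Finset (MarketPair N K)} {d : ℕ}
    (hd : 0 < d) (hS : maxDegree S ≤ d) :
    degreeMatrix S d ∈ doublyStochastic ℝ (Fin N ⊕ Fin K) := by
  have hd' : (0 : ℝ) < d := by exact_mod_cast hd
  have hdeg := maxDegree_le_iff.1 hS
  have row (i : Fin N ⊕ Fin K) : ∑ j, degreeMatrix S d i j = 1 := by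
    rcases i with p | a
    · rw [Fintype.sum_sum_type]
      simp only [degreeMatrix, Finset.sum_ite_eq, Finset.mem_univ, if_true, ← Finset.sum_filter,
        Finset.sum_const, nsmul_eq_mul, card_filter_fst_eq]
      ring
    · rw [Fintype.sum_sum_type]
      simp only [degreeMatrix, Finset.sum_ite_eq, Finset.mem_univ, if_true, ← Finset.sum_filter,
        Finset.sum_const, nsmul_eq_mul, card_filter_snd_eq]
      ring
  refine mem_doublyStochastic_iff_sum.2 ⟨?_, row, fun j => ?_⟩
  · rintro (p | a) (q | b) <;> simp only [degreeMatrix] <;> split_ifs <;> try positivity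
    · rw [sub_nonneg, div_le_one hd']
      exact_mod_cast hdeg.1 p
    · rw [sub_nonneg, div_le_one hd']
      exact_mod_cast hdeg.2 a
  · simp_rw [degreeMatrix_symm S d _ j]
    exact row j

/-- By Birkhoff's theorem the matrix is a convex combination of permutation matrices; any
permutation of positive weight lies in its support. -/
theorem exists_perm_pos_of_mem_doublyStochastic {n : Type*} [Fintype n] [DecidableEq n]
    {M : Matrix n n ℝ} (hM : M ∈ doublyStochastic ℝ n) :
    ∃ σ : Equiv.Perm n, ∀ i, 0 < M i (σ i) := by
  obtain ⟨w, hw, hw1, rfl⟩ := exists_eq_sum_perm_of_mem_doublyStochastic hM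
  obtain ⟨σ, -, hσ⟩ : ∃ σ ∈ Finset.univ, 0 < w σ :=
    Finset.exists_lt_of_sum_lt (f := fun _ => 0) (by simp [hw1])
  refine ⟨σ, fun i => ?_⟩
  rw [Matrix.sum_apply]
  refine Finset.sum_pos' (fun τ _ => ?_) ⟨σ, Finset.mem_univ _, ?_⟩
  · simp only [Matrix.smul_apply, smul_eq_mul, Equiv.Perm.permMatrix, PEquiv.toMatrix_apply]
    have := hw τ
    positivity
  · simpa [Equiv.Perm.permMatrix, PEquiv.toMatrix_apply] using hσ

/-- A bipartite graph has a matching that covers all vertices of maximum degree. -/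
theorem exists_isMatching_maxDegree_sdiff {N K : ℕ} {S : Finset (MarketPair N K)} {d : ℕ}
    (hS : maxDegree S ≤ d + 1) :
    ∃ m ⊆ S, IsMatching m ∧ maxDegree (S \ m) ≤ d := by
  obtain ⟨σ, hσ⟩ := exists_perm_pos_of_mem_doublyStochastic
    (degreeMatrix_mem_doublyStochastic d.succ_pos hS)
  have hd : ((d + 1 : ℕ) : ℝ) ≠ 0 := by positivity
  have hdeg := maxDegree_le_iff.1 hS
  have hsub : (Finset.univ.filter fun x : MarketPair N K => σ (.inl x.1) = .inr x.2) ⊆ S := by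
    rintro ⟨p, a⟩ h
    have h1 := hσ (.inl p)
    rw [(Finset.mem_filter.1 h).2] at h1
    by_contra h2
    simp [degreeMatrix, h2] at h1
  refine ⟨_, hsub, ?_, maxDegree_le_iff.2 ⟨fun p => ?_, fun a => ?_⟩⟩
  · rintro ⟨p, a⟩ h ⟨q, b⟩ h' hne
    simp only [Finset.mem_filter, Finset.mem_univ, true_and] at h h'
    refine ⟨fun hpq => hne ?_, fun hab => hne ?_⟩
    · simp only at hpq
      subst hpq
      rw [h] at h'
      simp_all
    · simp only at hab
      subst hab
      have := σ.injective (h.trans h'.symm)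
      simp_all
  · by_contra! hlt
    have hle : ((S \ Finset.univ.filter fun x : MarketPair N K => σ (.inl x.1) = .inr x.2).filter
        fun x => x.1 = p) ⊆ S.filter fun x => x.1 = p :=
      Finset.filter_subset_filter _ Finset.sdiff_subset
    have heq := Finset.eq_of_subset_of_card_le hle ((hdeg.1 p).trans hlt)
    have hcard : (S.filter fun x => x.1 = p).card = d + 1 :=
      le_antisymm (hdeg.1 p) (by rw [← heq]; exact hlt)
    -- A player of full degree d + 1 has diagonal entry zero, so `σ` must send it to an arm; the
    -- resulting edge has been removed from `S`, against `heq`.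
    have h1 := hσ (.inl p)
    rcases h2 : σ (.inl p) with q | a
    · rw [h2] at h1
      simp only [degreeMatrix, hcard, div_self hd, sub_self, ite_self, lt_irrefl] at h1
    · have h3 : (p, a) ∈ S := hsub (by simp [h2])
      have h4 : (p, a) ∈ S.filter fun x => x.1 = p := by simp [h3]
      rw [← heq] at h4
      simp [h2] at h4
  · by_contra! hlt
    have hle : ((S \ Finset.univ.filter fun x : MarketPair N K => σ (.inl x.1) = .inr x.2).filter
        fun x => x.2 = a) ⊆ S.filter fun x => x.2 = a :=
      Finset.filter_subset_filter _ Finset.sdiff_subset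
    have heq := Finset.eq_of_subset_of_card_le hle ((hdeg.2 a).trans hlt)
    have hcard : (S.filter fun x => x.2 = a).card = d + 1 :=
      le_antisymm (hdeg.2 a) (by rw [← heq]; exact hlt)
    -- The matching uses only the arrows of `σ` from players to arms, so for an arm the preimage is
    -- the relevant vertex.
    have h1 := hσ (σ.symm (.inr a))
    rw [Equiv.apply_symm_apply] at h1
    rcases h2 : σ.symm (.inr a) with p | b
    · have h2' : σ (.inl p) = .inr a := by rw [← h2, Equiv.apply_symm_apply]
      have h3 : (p, a) ∈ S := hsub (by simp [h2'])
      have h4 : (p, a) ∈ S.filter fun x => x.2 = a := by simp [h3]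
      rw [← heq] at h4
      simp [h2'] at h4
    · rw [h2] at h1
      by_cases hb : b = a
      · subst hb
        simp only [degreeMatrix, hcard, div_self hd, sub_self, ite_self, lt_irrefl] at h1
      · simp [degreeMatrix, hb] at h1

/-- König's edge colouring theorem: the edges of a bipartite graph of maximum degree `d` are
covered by `d` matchings. -/
theorem exists_isMatchingCover_card_le {N K : ℕ} (d : ℕ) (S : Finset (MarketPair N K))
    (hS : maxDegree S ≤ d) : ∃ M, IsMatchingCover S M ∧ M.card ≤ d := by
  induction d generalizing S with
  | zero =>
    rw [eq_empty_of_maxDegree_eq_zero (Nat.le_zero.1 hS)]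
    exact ⟨∅, by simp [IsMatchingCover], by simp⟩
  | succ d ih =>
    obtain ⟨m, -, hm, hd⟩ := exists_isMatching_maxDegree_sdiff hS
    obtain ⟨M, hM, hcard⟩ := ih _ hd
    refine ⟨insert m M, ⟨?_, fun x hx => ?_⟩, (Finset.card_insert_le _ _).trans (by omega)⟩
    · intro m' hm'
      rcases Finset.mem_insert.1 hm' with rfl | h
      · exact hm
      · exact hM.1 _ h
    · by_cases hxm : x ∈ m
      · exact ⟨m, Finset.mem_insert_self _ _, hxm⟩
      · obtain ⟨m', hm', hx'⟩ := hM.2 x (Finset.mem_sdiff.2 ⟨hx, hxm⟩)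
        exact ⟨m', Finset.mem_insert_of_mem hm', hx'⟩

theorem IsMinimalMatchingCover.card_le_maxDegree {N K : ℕ} {S : Finset (MarketPair N K)}
    {M : Finset (Finset (MarketPair N K))} (h : IsMinimalMatchingCover S M) :
    M.card ≤ maxDegree S := by
  obtain ⟨M', hM', hcard⟩ := exists_isMatchingCover_card_le _ S le_rfl
  exact (h.2.1 M' hM').trans hcard

/-! ### Deferred acceptance -/

theorem Prefers.trans {n : ℕ} {π : Equiv.Perm (Fin n)} {x y z : Fin n} (h : Prefers π x y)
    (h' : Prefers π y z) : Prefers π x z :=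
  lt_trans (a := π.symm x) h h'

theorem Prefers.irrefl {n : ℕ} {π : Equiv.Perm (Fin n)} {x : Fin n} : ¬ Prefers π x x :=
  lt_irrefl (π.symm x)

theorem prefers_trichotomy {n : ℕ} (π : Equiv.Perm (Fin n)) (x y : Fin n) :
    Prefers π x y ∨ x = y ∨ Prefers π y x := by
  rcases lt_trichotomy (π.symm x) (π.symm y) with h | h | h
  · exact .inl h
  · exact .inr (.inl (π.symm.injective h))
  · exact .inr (.inr h)

section DeferredAcceptance

variable {N K : ℕ} {π : Fin N → Equiv.Perm (Fin K)} {ρ : Fin K → Equiv.Perm (Fin N)}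
  {R : Finset (MarketPair N K)}

theorem mem_daProposals {p : Fin N} {a : Fin K} :
    (p, a) ∈ daProposals π R ↔ (p, a) ∉ R ∧ ∀ b, Prefers (π p) b a → (p, b) ∈ R := by
  simp [daProposals]

theorem mem_daStep {p : Fin N} {a : Fin K} :
    (p, a) ∈ daStep π ρ R ↔ (p, a) ∈ R ∨
      ((p, a) ∈ daProposals π R ∧ ∃ q, (q, a) ∈ daProposals π R ∧ Prefers (ρ a) q p) := by
  simp [daStep]

theorem exists_mem_daProposals {p : Fin N} {a : Fin K} (h : (p, a) ∉ R) :
    ∃ b, (p, b) ∈ daProposals π R ∧ (b = a ∨ Prefers (π p) b a) := by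
  obtain ⟨b, hb, hmin⟩ := Finset.exists_min_image
    (Finset.univ.filter fun b => (p, b) ∉ R) (fun b => (π p).symm b) ⟨a, by simp [h]⟩
  simp only [Finset.mem_filter, Finset.mem_univ, true_and] at hb hmin
  refine ⟨b, mem_daProposals.2 ⟨hb, fun c hc => ?_⟩, ?_⟩
  · by_contra hcR
    exact absurd (hmin c hcR) (not_le.2 hc)
  · rcases prefers_trichotomy (π p) b a with h1 | h1 | h1
    · exact .inr h1
    · exact .inl h1
    · exact absurd (hmin a h) (not_le.2 h1)

theorem daProposals_unique {p : Fin N} {a b : Fin K} (ha : (p, a) ∈ daProposals π R)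
    (hb : (p, b) ∈ daProposals π R) : a = b := by
  rw [mem_daProposals] at ha hb
  rcases prefers_trichotomy (π p) a b with h | h | h
  · exact absurd (hb.2 _ h) ha.1
  · exact h
  · exact absurd (ha.2 _ h) hb.1

theorem subset_daStep : R ⊆ daStep π ρ R := Finset.subset_union_left

/-- Until a fixed point is reached, each iteration adds an element, which can happen at most
`Fintype.card α` times. -/
theorem iterate_eq_of_card_lt {α : Type*} [Fintype α] {f : Finset α → Finset α}
    (hf : ∀ s, s ⊆ f s) {n : ℕ} (hn : Fintype.card α ≤ n) (s : Finset α) :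
    f (f^[n] s) = f^[n] s := by
  have key (k : ℕ) : f (f^[k] s) = f^[k] s ∨ k ≤ (f^[k] s).card := by
    induction k with
    | zero => simp
    | succ k ih =>
      rw [Function.iterate_succ_apply']
      rcases eq_or_ne (f (f^[k] s)) (f^[k] s) with h | h
      · left; rw [h, h]
      · right
        have := Finset.card_lt_card ((hf (f^[k] s)).ssubset_of_ne h.symm)
        have := ih.resolve_left h
        omega
  rcases key n with h | h
  · exact h
  · have h1 : f^[n] s = Finset.univ := by
      rw [← Finset.card_eq_iff_eq_univ]
      exact le_antisymm (Finset.card_le_univ _) (hn.trans h)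
    rw [h1]
    exact Finset.univ_subset_iff.1 (hf _)

/-- Every rejected player has been replaced by a better one. -/
def RejectionsJustified (π : Fin N → Equiv.Perm (Fin K)) (ρ : Fin K → Equiv.Perm (Fin N))
    (R : Finset (MarketPair N K)) : Prop :=
  ∀ p a, (p, a) ∈ R → ∃ q, (q, a) ∈ daProposals π R ∧ Prefers (ρ a) q p

/-- An arm never rejects its favourite proposer, and a player that is not rejected repeats its
proposal. So the offer held by an arm can only improve. -/
theorem exists_best_proposer {q : Fin N} {a : Fin K} (hq : (q, a) ∈ daProposals π R) :
    ∃ q', (q', a) ∈ daProposals π (daStep π ρ R) ∧ (q' = q ∨ Prefers (ρ a) q' q) := by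
  obtain ⟨b, hb, hmin⟩ := Finset.exists_min_image
    (Finset.univ.filter fun b => (b, a) ∈ daProposals π R) (fun b => (ρ a).symm b)
    ⟨q, by simp [hq]⟩
  simp only [Finset.mem_filter, Finset.mem_univ, true_and] at hb hmin
  refine ⟨b, mem_daProposals.2 ⟨fun h => ?_, fun c hc => ?_⟩, ?_⟩
  · rcases mem_daStep.1 h with h | ⟨-, c, hc, hcb⟩
    · exact (mem_daProposals.1 hb).1 h
    · exact absurd (hmin c hc) (not_le.2 hcb)
  · exact subset_daStep ((mem_daProposals.1 hb).2 c hc)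
  · rcases prefers_trichotomy (ρ a) b q with h1 | h1 | h1
    · exact .inr h1
    · exact .inl h1
    · exact absurd (hmin q hq) (not_le.2 h1)

theorem RejectionsJustified.daStep (h : RejectionsJustified π ρ R) :
    RejectionsJustified π ρ (daStep π ρ R) := by
  intro p a hpa
  obtain ⟨q, hq, hqp⟩ : ∃ q, (q, a) ∈ daProposals π R ∧ Prefers (ρ a) q p := by
    rcases mem_daStep.1 hpa with h1 | ⟨-, h1⟩
    · exact h p a h1
    · exact h1
  obtain ⟨q', hq', h' | h'⟩ := exists_best_proposer (ρ := ρ) hq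
  · exact ⟨q', hq', h' ▸ hqp⟩
  · exact ⟨q', hq', h'.trans hqp⟩

/-- No pair of a stable matching is ever rejected. If `a` dropped its stable partner `p` for `q`,
then `q`, not yet rejected by its own partner in `m`, would like `a` better than that partner, and
`(q, a)` would block `m`. -/
theorem disjoint_daStep_of_isStable {m : Finset (MarketPair N K)} (hm : IsStable π ρ m)
    (h : Disjoint m R) : Disjoint m (daStep π ρ R) := by
  rw [Finset.disjoint_left] at h ⊢
  rintro ⟨p, a⟩ hpa hR
  rcases mem_daStep.1 hR with h1 | ⟨-, q, hq, hqp⟩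
  · exact h hpa h1
  have hqp' : q ≠ p := by
    rintro rfl
    exact Prefers.irrefl hqp
  have hqa : (q, a) ∉ m := fun hqa => (hm.1 _ hqa _ hpa (by simp [hqp'])).2 rfl
  refine hm.2 q a ⟨hqa, fun b hb => ?_, fun q' hq' => ?_⟩
  · rcases prefers_trichotomy (π q) a b with h1 | h1 | h1
    · exact h1
    · exact absurd (h1 ▸ hb) hqa
    · exact absurd ((mem_daProposals.1 hq).2 b h1) (h hb)
  · by_cases hpq : q' = p
    · exact hpq ▸ hqp
    · exact absurd rfl (hm.1 _ hq' _ hpa (by simp [hpq])).2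

end DeferredAcceptance

/-- Deferred acceptance returns the player-optimal stable matching. -/
theorem isPlayerOptimalStable_deferredAcceptance {N K : ℕ} (π : Fin N → Equiv.Perm (Fin K))
    (ρ : Fin K → Equiv.Perm (Fin N)) :
    IsPlayerOptimalStable π ρ (deferredAcceptance π ρ) := by
  have hfix : daStep π ρ ((daStep π ρ)^[N * K] ∅) = (daStep π ρ)^[N * K] ∅ :=
    iterate_eq_of_card_lt (fun _ => subset_daStep) (by simp) _
  have hjust : RejectionsJustified π ρ ((daStep π ρ)^[N * K] ∅) :=
    Function.Iterate.rec (RejectionsJustified π ρ) (fun _ _ h => absurd h (Finset.notMem_empty _))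
      (fun _ h => h.daStep) _
  have hdisj (m) (hm : IsStable π ρ m) : Disjoint m ((daStep π ρ)^[N * K] ∅) :=
    Function.Iterate.rec (Disjoint m) (Finset.disjoint_empty_right m)
      (fun _ h => disjoint_daStep_of_isStable hm h) _
  rw [deferredAcceptance]
  generalize (daStep π ρ)^[N * K] ∅ = R at *
  -- Optimality: a stable partner has never rejected its player, so the player's final proposal is
  -- at least as good.
  refine ⟨⟨?_, fun p a ⟨h1, h2, h3⟩ => ?_⟩, fun m hm p a hpa =>
    exists_mem_daProposals (Finset.disjoint_left.1 (hdisj m hm) hpa)⟩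
  · rintro ⟨p, a⟩ hx ⟨q, b⟩ hy hne
    refine ⟨fun hpq => hne ?_, fun hab => hne ?_⟩
    · simp only at hpq
      subst hpq
      rw [daProposals_unique hx hy]
    · simp only at hab
      subst hab
      have key {p q : Fin N} (hp : (p, a) ∈ daProposals π R) (hq : (q, a) ∈ daProposals π R) :
          ¬ Prefers (ρ a) q p := fun h => by
        have : (p, a) ∈ daStep π ρ R := mem_daStep.2 (.inr ⟨hp, q, hq, h⟩)
        rw [hfix] at this
        exact (mem_daProposals.1 hp).1 this
      rcases prefers_trichotomy (ρ a) p q with h | h | h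
      · exact absurd h (key hy hx)
      · rw [h]
      · exact absurd h (key hx hy)
  -- A player that would gain from `a` has already been rejected by `a`, which therefore holds a
  -- proposer it likes better.
  · have hR : (p, a) ∈ R := by
      by_contra hR
      obtain ⟨b, hb, rfl | hba⟩ := exists_mem_daProposals (π := π) hR
      · exact h1 hb
      · exact Prefers.irrefl (hba.trans (h2 b hb))
    obtain ⟨q, hq, hqp⟩ := hjust p a hR
    exact Prefers.irrefl (hqp.trans (h3 q hq))

/-- Sorting depends only on the order of the values. -/
theorem argsortDesc_congr {K : ℕ} {v w : Fin K → ℝ} (hv : Function.Injective v)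
    (h : ∀ a b, v a < v b → w a < w b) : argsortDesc v = argsortDesc w := by
  have hw : Function.Injective w := by
    intro a b hab
    by_contra hne
    rcases lt_or_gt_of_ne (hv.ne hne) with h1 | h1
    · exact (h _ _ h1).ne hab
    · exact (h _ _ h1).ne' hab
  refine Tuple.eq_sort_iff.2 ⟨fun i j hij => ?_, fun i j hij heq => ?_⟩
  · have h1 : -v (argsortDesc v i) ≤ -v (argsortDesc v j) :=
      Tuple.monotone_sort (fun a => -v a) hij
    simp only [Function.comp_apply, neg_le_neg_iff] at h1 ⊢
    rcases h1.lt_or_eq with h2 | h2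
    · exact (h _ _ h2).le
    · rw [hv h2]
  · exact absurd ((argsortDesc v).injective (hw (neg_injective heq))) hij.ne

/-! ### Degree-reducing sequences -/

section DegreeReducing

variable {N K : ℕ}

/-- Removing pairs one by one, one passes through all smaller degrees. -/
theorem exists_subset_mem_degreeReducingSets {S r : Finset (MarketPair N K)} (hr : r ⊆ S)
    (h : maxDegree (S \ r) < maxDegree S) : ∃ r' ⊆ r, r' ∈ degreeReducingSets S := by
  induction r using Finset.induction_on with
  | empty => simp at h
  | insert x r hx ih =>
    rw [Finset.insert_subset_iff] at hr
    by_cases hlt : maxDegree (S \ r) < maxDegree S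
    · obtain ⟨r', h1, h2⟩ := ih hr.2 hlt
      exact ⟨r', h1.trans (Finset.subset_insert _ _), h2⟩
    · refine ⟨_, Finset.Subset.refl _, Finset.insert_subset_iff.2 hr, ?_⟩
      have h1 : insert x (S \ insert x r) = S \ r := by
        ext y
        simp only [Finset.mem_insert, Finset.mem_sdiff]
        by_cases hy : y = x
        · subst hy; simp [hr.1, hx]
        · simp [hy]
      have h2 := maxDegree_insert_le x (S \ insert x r)
      rw [h1] at h2
      omega

theorem nonempty_of_mem_degreeReducingSets {S r : Finset (MarketPair N K)}
    (h : r ∈ degreeReducingSets S) : r.Nonempty := by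
  rw [Finset.nonempty_iff_ne_empty]
  rintro rfl
  have := h.2
  simp at this

/-- The pairs that are left after removal of the first `n` sets of a sequence. -/
def pairsAfter (r : Fin K → Finset (MarketPair N K)) (n : ℕ) : Finset (MarketPair N K) :=
  Finset.univ.filter fun x => ∀ i : Fin K, i.1 < n → x ∉ r i

theorem remainingPairs_eq (r : Fin K → Finset (MarketPair N K)) (i : Fin K) :
    remainingPairs r i = pairsAfter r i := by
  ext x
  simp [remainingPairs, pairsAfter]

theorem pairsAfter_sdiff (r : Fin K → Finset (MarketPair N K)) (i : Fin K) :
    pairsAfter r i \ r i = pairsAfter r (i + 1) := by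
  ext x
  simp only [pairsAfter, Finset.mem_sdiff, Finset.mem_filter, Finset.mem_univ, true_and]
  constructor
  · rintro ⟨h1, h2⟩ j hj
    rcases Nat.lt_succ_iff_lt_or_eq.1 hj with h | h
    · exact h1 j h
    · rwa [Fin.ext h]
  · exact fun h => ⟨fun j hj => h j (Nat.lt_succ_of_lt hj), h i (Nat.lt_succ_self _)⟩

namespace IsDegreeReducingSequence

variable {t : MarketPair N K → ℝ} {tie : MarketPair N K → ℕ} {r : Fin K → Finset (MarketPair N K)}

theorem mem (h : IsDegreeReducingSequence t tie r) (i : Fin K) :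
    r i ∈ degreeReducingSets (pairsAfter r i) :=
  remainingPairs_eq r i ▸ (h i).1

theorem maxDegree_pairsAfter_add (h : IsDegreeReducingSequence t tie r) {n : ℕ} (hn : n ≤ K) :
    maxDegree (pairsAfter r n) + n = maxDegree (Finset.univ : Finset (MarketPair N K)) := by
  induction n with
  | zero => simp [pairsAfter]
  | succ n ih =>
    have h1 := (h.mem ⟨n, hn⟩).2
    rw [pairsAfter_sdiff] at h1
    simp only at h1
    have := ih (Nat.le_of_succ_le hn)
    omega

theorem maxDegree_pairsAfter (h : IsDegreeReducingSequence t tie r) (hN : 1 ≤ N) (hNK : N ≤ K)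
    {n : ℕ} (hn : n ≤ K) : maxDegree (pairsAfter r n) = K - n := by
  have := h.maxDegree_pairsAfter_add hn
  rw [maxDegree_univ hN hNK] at this
  omega

/-- The largest pair of a set of the sequence is at most that of the following set: otherwise, the
union of the two sets without its largest pair would still reduce the degree. -/
theorem exists_le_succ (h : IsDegreeReducingSequence t tie r) (htie : Function.Injective tie)
    {i j : Fin K} (hij : j.1 = i.1 + 1) {x : MarketPair N K} (hx : x ∈ r i) :
    ∃ y ∈ r j, t x ≤ t y := by
  obtain ⟨z, hz, hmax⟩ := Finset.exists_max_image (r i) (fun y => toLex (t y, tie y)) ⟨x, hx⟩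
  suffices ∃ y ∈ r j, toLex (t z, tie z) ≤ toLex (t y, tie y) by
    obtain ⟨y, hy, hzy⟩ := this
    refine ⟨y, hy, ?_⟩
    have h1 := (hmax x hx).trans hzy
    exact (Prod.Lex.toLex_le_toLex.1 h1).elim le_of_lt fun h => h.1.le
  by_contra! hlt
  have hi := h.mem i
  have hj := h.mem j
  have hS : pairsAfter r j = pairsAfter r i \ r i := by rw [pairsAfter_sdiff, hij]
  rw [hS] at hj
  have hzS : z ∈ pairsAfter r i := hi.1 hz
  have hsub : (r i ∪ r j).erase z ⊆ pairsAfter r i :=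
    (Finset.erase_subset _ _).trans
      (Finset.union_subset hi.1 (hj.1.trans Finset.sdiff_subset))
  -- Removing both sets lowers the degree by two, and putting back the single pair `z` raises it by
  -- at most one.
  have hdeg : maxDegree (pairsAfter r i \ (r i ∪ r j).erase z) < maxDegree (pairsAfter r i) := by
    have h1 : pairsAfter r i \ (r i ∪ r j).erase z
        ⊆ insert z ((pairsAfter r i \ r i) \ r j) := by
      intro y hy
      simp only [Finset.mem_sdiff, Finset.mem_erase, Finset.mem_union, Finset.mem_insert] at hy ⊢
      tauto
    have h2 := (maxDegree_mono h1).trans (maxDegree_insert_le _ _)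
    have h3 := hi.2
    have h4 := hj.2
    omega
  obtain ⟨r', hr', hred⟩ := exists_subset_mem_degreeReducingSets hsub hdeg
  obtain ⟨y, hy, hle⟩ := (h i).2 r' (remainingPairs_eq r i ▸ hred)
  have hyz := hle z hz
  have hy' := Finset.mem_erase.1 (hr' hy)
  rcases Finset.mem_union.1 hy'.2 with h1 | h1
  -- Here the tie-breaking is essential: by injectivity of `tie`, equal keys force `y = z`, but `z`
  -- was erased.
  · have heq := le_antisymm hyz (hmax y h1)
    exact hy'.1 (htie (Prod.ext_iff.1 (toLex.injective heq)).2).symm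
  · exact absurd hyz (not_le.2 (hlt y h1))

theorem sSup_mono (h : IsDegreeReducingSequence t tie r) (htie : Function.Injective tie) :
    Monotone fun i => sSup (t '' (r i : Set (MarketPair N K))) := by
  have key (n : ℕ) (i j : Fin K) (hij : j.1 = i.1 + n) :
      sSup (t '' (r i : Set (MarketPair N K))) ≤ sSup (t '' (r j : Set (MarketPair N K))) := by
    induction n generalizing j with
    | zero => rw [Fin.ext hij]
    | succ n ih =>
      have hlt : i.1 + n < K := by have := j.2; omega
      refine (ih ⟨i.1 + n, hlt⟩ rfl).trans ?_
      refine csSup_le ((nonempty_of_mem_degreeReducingSets (h.mem _)).to_set.image t) ?_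
      rintro _ ⟨x, hx, rfl⟩
      obtain ⟨y, hy, hxy⟩ := h.exists_le_succ htie (j := j) (by rw [hij]; rfl) hx
      exact hxy.trans (le_csSup ((r j).finite_toSet.image t).bddAbove ⟨y, hy, rfl⟩)
  intro i j hij
  exact key (j.1 - i.1) i j (by have : i.1 ≤ j.1 := hij; omega)

theorem maxDegree_le_card (h : IsDegreeReducingSequence t tie r) (htie : Function.Injective tie)
    (hN : 1 ≤ N) (hNK : N ≤ K) {S : Finset (MarketPair N K)} {θ : ℝ} (hS : ∀ x ∈ S, θ < t x) :
    maxDegree S ≤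
      (Finset.univ.filter fun i => θ < sSup (t '' (r i : Set (MarketPair N K)))).card := by
  -- By monotonicity, the sets whose maximum exceeds θ form a final segment of the indices; all
  -- pairs of `S` survive the removal of the others.
  have hex : ∃ n ≤ K, (∀ i : Fin K, i.1 < n → sSup (t '' (r i : Set (MarketPair N K))) ≤ θ) ∧
      ∀ i : Fin K, n ≤ i.1 → θ < sSup (t '' (r i : Set (MarketPair N K))) := by
    by_cases hall : ∃ i : Fin K, θ < sSup (t '' (r i : Set (MarketPair N K)))
    · obtain ⟨i, hi, hmin⟩ := Finset.exists_min_image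
        (Finset.univ.filter fun i : Fin K => θ < sSup (t '' (r i : Set (MarketPair N K)))) id
        (by obtain ⟨i, hi⟩ := hall; exact ⟨i, by simpa using hi⟩)
      simp only [Finset.mem_filter, Finset.mem_univ, true_and, id] at hi hmin
      refine ⟨i, i.2.le, fun j hj => ?_, fun j hj => hi.trans_le (h.sSup_mono htie hj)⟩
      by_contra! hlt
      exact absurd (hmin j hlt) (not_le.2 hj)
    · push Not at hall
      exact ⟨K, le_rfl, fun i _ => hall i, fun i hi => absurd i.2 (not_lt.2 hi)⟩
  obtain ⟨n, hn, hle, hlt⟩ := hex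
  have hsub : S ⊆ pairsAfter r n := by
    intro x hx
    simp only [pairsAfter, Finset.mem_filter, Finset.mem_univ, true_and]
    intro i hi hxi
    have h1 : t x ≤ sSup (t '' (r i : Set (MarketPair N K))) :=
      le_csSup ((r i).finite_toSet.image t).bddAbove ⟨x, hxi, rfl⟩
    linarith [hle i hi, hS x hx]
  calc maxDegree S ≤ K - n := (maxDegree_mono hsub).trans (h.maxDegree_pairsAfter hN hNK hn).le
    _ = (Finset.univ.filter fun i : Fin K => n ≤ i.1).card := by
        have h1 := Finset.card_filter_add_card_filter_not (s := (Finset.univ : Finset (Fin K)))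
          (fun i => i.1 < n)
        simp only [not_lt, Finset.card_univ, Fintype.card_fin] at h1
        rw [Fin.card_filter_val_lt, min_eq_right hn] at h1
        omega
    _ ≤ _ := Finset.card_le_card fun i hi => by
        simp only [Finset.mem_filter, Finset.mem_univ, true_and] at hi ⊢
        exact hlt i hi

/-- Summation by layers. -/
theorem sum_maxDegree_le (h : IsDegreeReducingSequence t tie r) (htie : Function.Injective tie)
    (hN : 1 ≤ N) (hNK : N ≤ K) {c : ℝ} (hc : 0 < c) (ht : ∀ x, 0 ≤ t x)
    {A : ℕ → Finset (MarketPair N K)} (hA : ∀ n, ∀ x ∈ A n, (n : ℝ) < c * t x) (T : ℕ) :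
    ∑ n ∈ Finset.range T, (maxDegree (A n) : ℝ) ≤
      ∑ i, (c * sSup (t '' (r i : Set (MarketPair N K))) + 1) := by
  calc ∑ n ∈ Finset.range T, (maxDegree (A n) : ℝ)
      ≤ ∑ n ∈ Finset.range T, ∑ i : Fin K,
          if (n : ℝ) / c < sSup (t '' (r i : Set (MarketPair N K))) then (1 : ℝ) else 0 := by
        refine Finset.sum_le_sum fun n _ => ?_
        have h1 := h.maxDegree_le_card htie hN hNK (S := A n) (θ := n / c) fun x hx => by
          rw [div_lt_iff₀' hc]
          exact hA n x hx
        rw [← Finset.sum_filter, Finset.sum_const, nsmul_eq_mul, mul_one]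
        exact_mod_cast h1
    _ = ∑ i : Fin K, ∑ n ∈ Finset.range T,
          if (n : ℝ) / c < sSup (t '' (r i : Set (MarketPair N K))) then (1 : ℝ) else 0 :=
        Finset.sum_comm
    _ ≤ _ := by
        refine Finset.sum_le_sum fun i _ => ?_
        have hnn : 0 ≤ sSup (t '' (r i : Set (MarketPair N K))) :=
          Real.sSup_nonneg (by rintro _ ⟨x, -, rfl⟩; exact ht x)
        rw [← Finset.sum_filter, Finset.sum_const, nsmul_eq_mul, mul_one]
        -- After exchanging the sums, the i-th term counts the n ≥ 0 below c times the maximum of `r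
        -- i`; rounding up costs the extra 1.
        refine le_trans ?_ (Nat.ceil_lt_add_one (mul_nonneg hc.le hnn)).le
        have h1 : ((Finset.range T).filter fun n : ℕ =>
            (n : ℝ) / c < sSup (t '' (r i : Set (MarketPair N K)))) ⊆
            Finset.range ⌈c * sSup (t '' (r i : Set (MarketPair N K)))⌉₊ := by
          intro n hn
          have h2 := (Finset.mem_filter.1 hn).2
          rw [div_lt_iff₀' hc] at h2
          exact Finset.mem_range.2 (Nat.lt_ceil.2 h2)
        have h2 := Finset.card_le_card h1
        rw [Finset.card_range] at h2
        exact_mod_cast h2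

end IsDegreeReducingSequence

end DegreeReducing

/-! ### Runs of the elimination algorithm -/

theorem Icc_sub_add_inter_nonempty_iff {c d ε : ℝ} (hε : 0 ≤ ε) :
    (Set.Icc (c - ε) (c + ε) ∩ Set.Icc (d - ε) (d + ε)).Nonempty ↔ |c - d| ≤ 2 * ε := by
  rw [Set.Icc_inter_Icc, Set.nonempty_Icc, sup_le_iff, le_inf_iff, le_inf_iff, abs_le]
  constructor
  · rintro ⟨⟨-, h1⟩, h2, -⟩
    constructor <;> linarith
  · rintro ⟨h1, h2⟩
    refine ⟨⟨?_, ?_⟩, ?_, ?_⟩ <;> linarith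

theorem confRadius_nonneg (N K : ℕ) (δ : ℝ) (t : ℕ) : 0 ≤ confRadius N K δ t := Real.sqrt_nonneg _

/-- The mean of the rewards of the first `t` rounds. -/
noncomputable def rewardAverage {N K : ℕ} (x : ℕ → Fin N → Fin K → ℝ) (t : ℕ) (p : Fin N)
    (a : Fin K) : ℝ :=
  (∑ s ∈ Finset.range t, x (s + 1) p a) / t

section ElimRun

variable {N K : ℕ} {δ : ℝ} {cover : Finset (MarketPair N K) → Finset (Finset (MarketPair N K))}
  {x : ℕ → Fin N → Fin K → ℝ} {t : ℕ} {p : Fin N} {a : Fin K}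

theorem elimRun_succ_of_ne (h : (elimRun δ cover x t).active ≠ ∅) :
    elimRun δ cover x (t + 1) = elimRemove (confRadius N K δ (t + 1))
      (elimSample (cover (elimRun δ cover x t).active) (x (t + 1)) (elimRun δ cover x t)) := by
  simp [elimRun, h]

theorem elimRun_succ_of_eq (h : (elimRun δ cover x t).active = ∅) :
    elimRun δ cover x (t + 1) = elimRun δ cover x t := by
  simp [elimRun, h]

theorem active_succ_subset :
    (elimRun δ cover x (t + 1)).active ⊆ (elimRun δ cover x t).active := by
  by_cases h : (elimRun δ cover x t).active = ∅
  · rw [elimRun_succ_of_eq h]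
  · rw [elimRun_succ_of_ne h]
    exact Finset.filter_subset _ _

theorem active_antitone : Antitone fun t => (elimRun δ cover x t).active :=
  antitone_nat_of_succ_le fun _ => active_succ_subset

/-- Availability is never regained, so a pair still available has been sampled in every round so
far. -/
theorem samples_of_mem_active (h : (p, a) ∈ (elimRun δ cover x t).active) :
    (elimRun δ cover x t).numSamples p a = t ∧
      (elimRun δ cover x t).rewardSum p a = ∑ s ∈ Finset.range t, x (s + 1) p a := by
  induction t with
  | zero => simp [elimRun, elimInit]
  | succ t ih =>
    have h1 := active_succ_subset h
    obtain ⟨h2, h3⟩ := ih h1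
    rw [elimRun_succ_of_ne (Finset.ne_empty_of_mem h1)]
    simp [elimRemove, elimSample, h1, h2, h3, Finset.sum_range_succ]

theorem estimate_elimSample (h : (p, a) ∈ (elimRun δ cover x t).active)
    (M : Finset (Finset (MarketPair N K))) :
    (elimSample M (x (t + 1)) (elimRun δ cover x t)).estimate p a =
      rewardAverage x (t + 1) p a := by
  obtain ⟨h2, h3⟩ := samples_of_mem_active h
  simp [ElimState.estimate, rewardAverage, elimSample, h, h2, h3, Finset.sum_range_succ]

theorem estimate_succ_of_mem (h : (p, a) ∈ (elimRun δ cover x t).active) :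
    (elimRun δ cover x (t + 1)).estimate p a = rewardAverage x (t + 1) p a := by
  rw [elimRun_succ_of_ne (Finset.ne_empty_of_mem h), ← estimate_elimSample h (cover (elimRun δ cover x t).active)]
  rfl

theorem estimate_succ_of_notMem (h : (p, a) ∉ (elimRun δ cover x t).active) :
    (elimRun δ cover x (t + 1)).estimate p a = (elimRun δ cover x t).estimate p a := by
  by_cases h0 : (elimRun δ cover x t).active = ∅
  · rw [elimRun_succ_of_eq h0]
  · rw [elimRun_succ_of_ne h0]
    simp [elimRemove, elimSample, h, ElimState.estimate]

/-- All intervals of a round have the same radius ε, so two of them meet iff their centres differ by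
at most 2ε. A player's last available arm has no competitor `j` and drops out by itself. -/
theorem mem_active_succ :
    (p, a) ∈ (elimRun δ cover x (t + 1)).active ↔ (p, a) ∈ (elimRun δ cover x t).active ∧
      ∃ j, j ≠ a ∧ (p, j) ∈ (elimRun δ cover x t).active ∧
        |rewardAverage x (t + 1) p a - rewardAverage x (t + 1) p j| ≤
          2 * confRadius N K δ (t + 1) := by
  by_cases h0 : (elimRun δ cover x t).active = ∅
  · rw [elimRun_succ_of_eq h0]
    simp [h0]
  · rw [elimRun_succ_of_ne h0]
    simp only [elimRemove, Finset.mem_filter]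
    refine and_congr_right fun ha => ?_
    push Not
    refine exists_congr fun j => and_congr_right fun _ => and_congr_right fun hj => ?_
    rw [ElimState.confInterval, ElimState.confInterval, estimate_elimSample ha,
      estimate_elimSample hj, Icc_sub_add_inter_nonempty_iff (confRadius_nonneg _ _ _ _)]

/-- A pair that is no longer available was removed in some round, and its estimate is the average
up to that round. -/
theorem exists_removal_round (h : (p, a) ∉ (elimRun δ cover x t).active) :
    ∃ s, (p, a) ∈ (elimRun δ cover x s).active ∧ (p, a) ∉ (elimRun δ cover x (s + 1)).active ∧
      (elimRun δ cover x t).estimate p a = rewardAverage x (s + 1) p a := by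
  induction t with
  | zero => simp [elimRun, elimInit] at h
  | succ t ih =>
    by_cases h1 : (p, a) ∈ (elimRun δ cover x t).active
    · exact ⟨t, h1, h, estimate_succ_of_mem h1⟩
    · rw [estimate_succ_of_notMem h1]
      exact ih h1

theorem numMatchings_le (hcover : ∀ S, IsMinimalMatchingCover S (cover S)) (T : ℕ) :
    (elimRun δ cover x T).numMatchings ≤
      ∑ t ∈ Finset.range T, maxDegree (elimRun δ cover x t).active := by
  induction T with
  | zero => simp [elimRun, elimInit]
  | succ T ih =>
    rw [Finset.sum_range_succ]
    by_cases h0 : (elimRun δ cover x T).active = ∅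
    · rw [elimRun_succ_of_eq h0]
      exact ih.trans (Nat.le_add_right _ _)
    · rw [elimRun_succ_of_ne h0]
      exact Nat.add_le_add ih (hcover _).card_le_maxDegree

theorem active_eq_empty_of_le_one (hK : K ≤ 1) : (elimRun δ cover x 1).active = ∅ := by
  rw [Finset.eq_empty_iff_forall_notMem]
  rintro ⟨p, a⟩ h
  obtain ⟨-, j, hj, -⟩ := mem_active_succ.1 h
  have := a.2
  have := j.2
  exact hj (Fin.ext (by omega))

/-- All averages are within the confidence radius of the values `v`. -/
def AveragesAccurate (δ : ℝ) (x : ℕ → Fin N → Fin K → ℝ) (v : Fin N → Fin K → ℝ) : Prop :=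
  ∀ t p a, |rewardAverage x (t + 1) p a - v p a| ≤ confRadius N K δ (t + 1)

theorem minGap_le {v : Fin N → Fin K → ℝ} {b : Fin K} (h : b ≠ a) :
    minGap v (p, a) ≤ |v p a - v p b| :=
  ciInf_le (f := fun b : {b : Fin K // b ≠ a} => |v p a - v p b|)
    ⟨0, by rintro _ ⟨b, rfl⟩; exact abs_nonneg _⟩ ⟨b, h⟩

/-- Survival needs a competitor whose average is within two radii; each average contributes one more
radius of error, so the means would be within four. -/
theorem notMem_active_of_four_mul_confRadius_lt {v : Fin N → Fin K → ℝ}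
    (hx : AveragesAccurate δ x v) (h : 4 * confRadius N K δ (t + 1) < minGap v (p, a)) :
    (p, a) ∉ (elimRun δ cover x (t + 1)).active := by
  rw [mem_active_succ]
  rintro ⟨-, j, hj, -, hle⟩
  have h1 := minGap_le (v := v) (p := p) hj
  have h2 := abs_le.1 (hx t p a)
  have h3 := abs_le.1 (hx t p j)
  have h4 := abs_le.1 hle
  rcases abs_cases (v p a - v p j) with h5 | h5 <;> linarith

/-- Consider the arm removed first (or at the same time), in round s + 1. Its average is then more
than two radii from that of the other arm, on the correct side by accuracy. The other mean is thus
more than one radius away from this frozen estimate, and its own final estimate errs by at most that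
radius. -/
theorem estimate_lt_estimate {v : Fin N → Fin K → ℝ} (hx : AveragesAccurate δ x v)
    (hanti : Antitone fun t => confRadius N K δ (t + 1))
    (h : (elimRun δ cover x t).active = ∅) {b : Fin K} (hab : v p a < v p b) :
    (elimRun δ cover x t).estimate p a < (elimRun δ cover x t).estimate p b := by
  have hne : a ≠ b := by rintro rfl; exact lt_irrefl _ hab
  obtain ⟨s, hs, hs', hes⟩ := exists_removal_round (p := p) (a := a) (t := t)
    (δ := δ) (cover := cover) (x := x) (by simp [h])
  obtain ⟨u, hu, hu', heu⟩ := exists_removal_round (p := p) (a := b) (t := t)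
    (δ := δ) (cover := cover) (x := x) (by simp [h])
  rw [hes, heu]
  rcases le_total s u with hsu | hsu
  · have hb : (p, b) ∈ (elimRun δ cover x s).active := active_antitone hsu hu
    have h1 : 2 * confRadius N K δ (s + 1) <
        |rewardAverage x (s + 1) p a - rewardAverage x (s + 1) p b| := by
      by_contra! hle
      exact hs' (mem_active_succ.2 ⟨hs, b, hne.symm, hb, hle⟩)
    have h2 := abs_le.1 (hx s p a)
    have h3 := abs_le.1 (hx s p b)
    have h4 := abs_le.1 (hx u p b)
    have h5 : confRadius N K δ (u + 1) ≤ confRadius N K δ (s + 1) := hanti hsu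
    rcases abs_cases (rewardAverage x (s + 1) p a - rewardAverage x (s + 1) p b) with h6 | h6 <;>
      linarith
  · have ha : (p, a) ∈ (elimRun δ cover x u).active := active_antitone hsu hs
    have h1 : 2 * confRadius N K δ (u + 1) <
        |rewardAverage x (u + 1) p b - rewardAverage x (u + 1) p a| := by
      by_contra! hle
      exact hu' (mem_active_succ.2 ⟨hu, a, hne, ha, hle⟩)
    have h2 := abs_le.1 (hx u p a)
    have h3 := abs_le.1 (hx u p b)
    have h4 := abs_le.1 (hx s p a)
    have h5 : confRadius N K δ (s + 1) ≤ confRadius N K δ (u + 1) := hanti hsu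
    rcases abs_cases (rewardAverage x (u + 1) p b - rewardAverage x (u + 1) p a) with h6 | h6 <;>
      linarith

theorem isPlayerOptimalStable_output {v : Fin N → Fin K → ℝ} (hv : ∀ p, Function.Injective (v p))
    (ρ : Fin K → Equiv.Perm (Fin N)) {s : ElimState N K}
    (hs : ∀ p a b, v p a < v p b → s.estimate p a < s.estimate p b) :
    IsPlayerOptimalStable (fun p => argsortDesc (v p)) ρ (s.output ρ) := by
  have h : (fun p => argsortDesc (v p)) = fun p => argsortDesc (s.estimate p) :=
    funext fun p => argsortDesc_congr (hv p) (hs p)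
  rw [h]
  exact isPlayerOptimalStable_deferredAcceptance _ ρ

end ElimRun

/-! ### Confidence radii -/

theorem eight_le_of_two_le {N K : ℕ} {δ : ℝ} (hN : 1 ≤ N) (hK : 2 ≤ K) (hδ : 0 < δ)
    (hδ1 : δ ≤ 1) : 8 ≤ 4 * (K : ℝ) * N / δ := by
  have hN' : (1 : ℝ) ≤ N := by exact_mod_cast hN
  have hK' : (2 : ℝ) ≤ K := by exact_mod_cast hK
  rw [le_div_iff₀ hδ]
  nlinarith

theorem two_le_log_eight : (2 : ℝ) ≤ Real.log 8 := by
  have h : Real.log 8 = 3 * Real.log 2 := by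
    rw [show (8 : ℝ) = 2 ^ 3 by norm_num, Real.log_pow]; norm_num
  linarith [Real.log_two_gt_d9]

/-- The derivative of log (c y²) / y has the sign of 2 - log (c y²), which is nonpositive on [1, ∞)
once c ≥ e². The value 8 > e² is what K ≥ 2 provides. -/
theorem log_div_antitone {c : ℝ} (hc : 8 ≤ c) {x y : ℝ} (hx : 1 ≤ x) (hxy : x ≤ y) :
    Real.log (c * y ^ 2) / (2 * y) ≤ Real.log (c * x ^ 2) / (2 * x) := by
  have hx0 : 0 < x := by linarith
  have hy0 : 0 < y := by linarith
  have hc0 : 0 < c := by linarith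
  have hlogc : 2 ≤ Real.log c := two_le_log_eight.trans (Real.log_le_log (by norm_num) hc)
  have hlx : 0 ≤ Real.log x := Real.log_nonneg hx
  have e (z : ℝ) (hz : 0 < z) : Real.log (c * z ^ 2) = Real.log c + 2 * Real.log z := by
    rw [Real.log_mul hc0.ne' (by positivity), Real.log_pow]; norm_num
  rw [e x hx0, e y hy0, div_le_div_iff₀ (by positivity) (by positivity)]
  have h1 : Real.log y - Real.log x ≤ y / x - 1 := by
    rw [← Real.log_div hy0.ne' hx0.ne']
    exact Real.log_le_sub_one_of_pos (by positivity)
  have h2 : (Real.log y - Real.log x) * x ≤ y - x := by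
    calc _ ≤ (y / x - 1) * x := mul_le_mul_of_nonneg_right h1 hx0.le
      _ = y - x := by field_simp
  nlinarith [mul_nonneg (sub_nonneg.2 hlogc) (sub_nonneg.2 hxy),
    mul_nonneg hlx (sub_nonneg.2 hxy)]

theorem confRadius_antitone {N K : ℕ} {δ : ℝ} (hN : 1 ≤ N) (hK : 2 ≤ K) (hδ : 0 < δ)
    (hδ1 : δ ≤ 1) : Antitone fun t => confRadius N K δ (t + 1) := by
  intro s t hst
  refine Real.sqrt_le_sqrt ?_
  have h1 : (1 : ℝ) ≤ ((s + 1 : ℕ) : ℝ) := by exact_mod_cast Nat.succ_le_succ (Nat.zero_le s)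
  have h2 : ((s + 1 : ℕ) : ℝ) ≤ ((t + 1 : ℕ) : ℝ) := by exact_mod_cast Nat.succ_le_succ hst
  have := log_div_antitone (eight_le_of_two_le hN hK hδ hδ1) h1 h2
  rwa [div_mul_eq_mul_div, div_mul_eq_mul_div] at this

/-- With b = K N / δ and u = 1 / Δ, the conclusion is the squared form of 4 ε_t < Δ. -/
theorem log_bound {b u t : ℝ} (hb : 2 ≤ b) (hu : 1 ≤ u)
    (ht : 256 * (Real.log (b * u) * u ^ 2) ≤ t) :
    8 * Real.log (4 * b * t ^ 2) * u ^ 2 < t := by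
  have hb0 : 0 < b := by linarith
  have hu0 : 0 < u := by linarith
  have hlu : 0 ≤ Real.log u := Real.log_nonneg hu
  have hlb : Real.log 2 ≤ Real.log b := Real.log_le_log (by norm_num) hb
  have hl2 := Real.log_two_gt_d9
  have hl2' := Real.log_two_lt_d9
  have hL : Real.log (b * u) = Real.log b + Real.log u := Real.log_mul hb0.ne' hu0.ne'
  have hu2 : 0 < u ^ 2 := by positivity
  obtain ⟨s, rfl⟩ : ∃ s, t = s * u ^ 2 := ⟨t / u ^ 2, by field_simp⟩
  have hs : 256 * Real.log (b * u) ≤ s := by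
    rw [← mul_assoc] at ht
    exact le_of_mul_le_mul_right ht hu2
  have hs0 : 0 < s := by linarith
  refine mul_lt_mul_of_pos_right ?_ hu2
  have h4 : Real.log 4 = 2 * Real.log 2 := by
    rw [show (4 : ℝ) = 2 ^ 2 by norm_num, Real.log_pow]; norm_num
  have h32 : Real.log 32 = 5 * Real.log 2 := by
    rw [show (32 : ℝ) = 2 ^ 5 by norm_num, Real.log_pow]; norm_num
  have e : Real.log (4 * b * (s * u ^ 2) ^ 2) =
      Real.log 4 + Real.log b + 2 * Real.log s + 4 * Real.log u := by
    rw [Real.log_mul (by positivity) (by positivity), Real.log_mul (by norm_num) hb0.ne',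
      Real.log_pow, Real.log_mul hs0.ne' hu2.ne', Real.log_pow]
    push_cast
    ring
  -- The tangent of log at 32: the term 16 log s then uses up only half of s, and the other half, at
  -- least 128 log (b u), pays for the rest.
  have h1 : Real.log s ≤ s / 32 - 1 + Real.log 32 := by
    have := Real.log_le_sub_one_of_pos (show 0 < s / 32 by positivity)
    rw [Real.log_div hs0.ne' (by norm_num)] at this
    linarith
  rw [e]
  linarith

/-! ### Gaps and sample bounds of the pairs. -/

section SampleBound

variable {N K : ℕ} {v : Fin N → Fin K → ℝ} {δ : ℝ}

theorem nonempty_ne_of_two_le (hK : 2 ≤ K) (a : Fin K) : Nonempty {b : Fin K // b ≠ a} := by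
  have : Nontrivial (Fin K) := Fin.nontrivial_iff_two_le.2 hK
  obtain ⟨b, hb⟩ := exists_ne a
  exact ⟨⟨b, hb⟩⟩

theorem minGap_pos (hK : 2 ≤ K) (hv : ∀ p, Function.Injective (v p)) (x : MarketPair N K) :
    0 < minGap v x := by
  have := nonempty_ne_of_two_le hK x.2
  obtain ⟨b, hb⟩ := exists_eq_ciInf_of_finite
    (f := fun b : {b : Fin K // b ≠ x.2} => |v x.1 x.2 - v x.1 b|)
  rw [minGap, ← hb]
  exact abs_pos.2 (sub_ne_zero.2 ((hv x.1).ne b.2.symm))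

theorem minGap_le_one (hK : 2 ≤ K) (hv : ∀ p a, v p a ∈ Set.Icc (0 : ℝ) 1)
    (x : MarketPair N K) : minGap v x ≤ 1 := by
  obtain ⟨b, hb⟩ := nonempty_ne_of_two_le hK x.2
  refine (minGap_le (p := x.1) hb).trans (abs_le.2 ?_)
  have h1 := hv x.1 x.2
  have h2 := hv x.1 b
  constructor <;> linarith [h1.1, h1.2, h2.1, h2.2]

theorem two_le_mul_div (hN : 1 ≤ N) (hK : 2 ≤ K) (hδ : 0 < δ) (hδ1 : δ ≤ 1) :
    2 ≤ (K : ℝ) * N / δ := by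
  have := eight_le_of_two_le hN hK hδ hδ1
  have e : 4 * (K : ℝ) * N / δ = 4 * (K * N / δ) := by ring
  linarith

theorem sampleBound_eq (x : MarketPair N K) :
    sampleBound δ v x =
      Real.log (K * N / δ * (minGap v x)⁻¹) * (minGap v x)⁻¹ ^ 2 := by
  rw [sampleBound, inv_pow, ← div_eq_mul_inv, ← div_eq_mul_inv, div_div]

theorem log_two_le_sampleBound (hN : 1 ≤ N) (hK : 2 ≤ K) (hδ : 0 < δ) (hδ1 : δ ≤ 1)
    (hinj : ∀ p, Function.Injective (v p)) (hv : ∀ p a, v p a ∈ Set.Icc (0 : ℝ) 1)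
    (x : MarketPair N K) : Real.log 2 ≤ sampleBound δ v x := by
  have hu : 1 ≤ (minGap v x)⁻¹ := (one_le_inv₀ (minGap_pos hK hinj x)).2 (minGap_le_one hK hv x)
  have hb := two_le_mul_div hN hK hδ hδ1
  rw [sampleBound_eq]
  have h1 : Real.log 2 ≤ Real.log (K * N / δ * (minGap v x)⁻¹) :=
    Real.log_le_log (by norm_num) (by nlinarith)
  have h2 : 0 ≤ Real.log 2 := Real.log_nonneg (by norm_num)
  exact h1.trans (le_mul_of_one_le_right (h2.trans h1) (one_le_pow₀ hu))

theorem four_mul_confRadius_lt_minGap (hN : 1 ≤ N) (hK : 2 ≤ K) (hδ : 0 < δ) (hδ1 : δ ≤ 1)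
    (hinj : ∀ p, Function.Injective (v p)) (hv : ∀ p a, v p a ∈ Set.Icc (0 : ℝ) 1)
    (x : MarketPair N K) {t : ℕ} (ht : 256 * sampleBound δ v x ≤ t) :
    4 * confRadius N K δ t < minGap v x := by
  have hpos := minGap_pos hK hinj x
  have hu : 1 ≤ (minGap v x)⁻¹ := (one_le_inv₀ hpos).2 (minGap_le_one hK hv x)
  have hl2 : 0 < Real.log 2 := Real.log_pos (by norm_num)
  have ht0 : (0 : ℝ) < t := by
    linarith [log_two_le_sampleBound hN hK hδ hδ1 hinj hv x]
  rw [sampleBound_eq] at ht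
  have h1 := log_bound (two_le_mul_div hN hK hδ hδ1) hu ht
  have h2 : confRadius N K δ t < minGap v x / 4 := by
    rw [confRadius, Real.sqrt_lt' (by positivity), div_lt_iff₀ (by positivity)]
    rw [inv_pow, ← div_eq_mul_inv, div_lt_iff₀ (by positivity)] at h1
    have e : 4 * (K : ℝ) * N * (t : ℝ) ^ 2 / δ = 4 * (K * N / δ) * t ^ 2 := by ring
    rw [e]
    linarith
  linarith

end SampleBound

/-- What an accurate run achieves. -/
theorem elimRun_of_averagesAccurate {N K : ℕ} {v : Fin N → Fin K → ℝ} {δ : ℝ}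
    {cover : Finset (MarketPair N K) → Finset (Finset (MarketPair N K))}
    {x : ℕ → Fin N → Fin K → ℝ} (hcover : ∀ S, IsMinimalMatchingCover S (cover S))
    (hN : 1 ≤ N) (hNK : N ≤ K) (hK : 2 ≤ K) (hδ : 0 < δ) (hδ1 : δ ≤ 1)
    (hinj : ∀ p, Function.Injective (v p)) (hv : ∀ p a, v p a ∈ Set.Icc (0 : ℝ) 1)
    (hx : AveragesAccurate δ x v) (ρ : Fin K → Equiv.Perm (Fin N)) :
    ∃ T, (elimRun δ cover x T).active = ∅ ∧
      IsPlayerOptimalStable (fun p => argsortDesc (v p)) ρ ((elimRun δ cover x T).output ρ) ∧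
      ∀ (tie : MarketPair N K → ℕ), Function.Injective tie →
        ∀ r : Fin K → Finset (MarketPair N K),
          IsDegreeReducingSequence (sampleBound δ v) tie r →
          ((elimRun δ cover x T).numMatchings : ℝ) ≤
            258 * ∑ s, sSup (sampleBound δ v '' (r s : Set (MarketPair N K))) := by
  have hl2 := Real.log_two_gt_d9
  have hpos (y : MarketPair N K) := log_two_le_sampleBound hN hK hδ hδ1 hinj hv y
  have hactive (n : ℕ) : ∀ y ∈ (elimRun δ cover x n).active,
      (n : ℝ) < 256 * sampleBound δ v y := by
    intro y hy
    by_contra! hle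
    cases n with
    -- Round 0 has no confidence radius; here positivity of `sampleBound` suffices.
    | zero =>
      have := hpos y
      rw [Nat.cast_zero] at hle
      linarith
    | succ n =>
      exact notMem_active_of_four_mul_confRadius_lt hx
        (four_mul_confRadius_lt_minGap hN hK hδ hδ1 hinj hv y hle) hy
  obtain ⟨T, hT⟩ : ∃ T, (elimRun δ cover x T).active = ∅ := by
    obtain ⟨T, hT⟩ := exists_nat_ge (256 * ∑ y, sampleBound δ v y)
    refine ⟨T, Finset.eq_empty_iff_forall_notMem.2 fun y hy => ?_⟩
    have h1 := hactive T y hy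
    have h2 : sampleBound δ v y ≤ ∑ y, sampleBound δ v y :=
      Finset.single_le_sum (fun z _ => by linarith [hpos z]) (Finset.mem_univ y)
    linarith
  refine ⟨T, hT, isPlayerOptimalStable_output hinj ρ fun p a b hab =>
    estimate_lt_estimate hx (confRadius_antitone hN hK hδ hδ1) hT hab, fun tie htie r hr => ?_⟩
  have h1 : ((elimRun δ cover x T).numMatchings : ℝ) ≤
      ∑ n ∈ Finset.range T, (maxDegree (elimRun δ cover x n).active : ℝ) := by
    exact_mod_cast numMatchings_le hcover T
  refine h1.trans ((hr.sum_maxDegree_le htie hN hNK (c := 256) (by norm_num)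
    (fun y => by linarith [hpos y]) hactive T).trans ?_)
  rw [Finset.mul_sum]
  refine Finset.sum_le_sum fun i _ => ?_
  -- The rounding term 1 is at most 2 log 2, hence at most twice the maximum over `r i`: this turns
  -- 256 into 258.
  obtain ⟨y, hy⟩ := nonempty_of_mem_degreeReducingSets (hr.mem i)
  have h2 : sampleBound δ v y ≤ sSup (sampleBound δ v '' (r i : Set (MarketPair N K))) :=
    le_csSup ((r i).finite_toSet.image _).bddAbove ⟨y, hy, rfl⟩
  linarith [hpos y]

/-! ### Concentration of the averages -/

theorem tsum_ofReal_mul_one_div_sq_le {c : ℝ} (hc : 0 ≤ c) :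
    ∑' t : ℕ, ENNReal.ofReal (c * (1 / ((t + 1 : ℕ) : ℝ) ^ 2)) ≤ ENNReal.ofReal (2 * c) := by
  have h1 : HasSum (fun t : ℕ => 1 / ((t + 1 : ℕ) : ℝ) ^ 2) (Real.pi ^ 2 / 6) := by
    have := (hasSum_nat_add_iff' 1).2 hasSum_zeta_two
    simpa using this
  have h2 := h1.mul_left c
  rw [← ENNReal.ofReal_tsum_of_nonneg (fun t => by positivity) h2.summable, h2.tsum_eq]
  refine ENNReal.ofReal_le_ofReal ?_
  have h3 : Real.pi ^ 2 / 6 ≤ 2 := by nlinarith [Real.pi_lt_d2, Real.pi_pos]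
  rw [mul_comm 2]
  exact mul_le_mul_of_nonneg_left h3 hc

section Concentration

variable {N K : ℕ} {Ω : Type*} [MeasurableSpace Ω] {μ : Measure Ω}
  {D : Fin N → Fin K → Measure ℝ} {X : ℕ → Fin N → Fin K → Ω → ℝ}

namespace IsRewardProcess

theorem ae_mem_Icc (h : IsRewardProcess μ D X) (t : ℕ) (p : Fin N) (a : Fin K) :
    ∀ᵐ ω ∂μ, X t p a ω ∈ Set.Icc (0 : ℝ) 1 := by
  refine ae_of_ae_map (h.measurable t p a).aemeasurable (p := fun x => x ∈ Set.Icc (0 : ℝ) 1) ?_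
  rw [h.law]
  exact h.support p a

theorem integral_eq (h : IsRewardProcess μ D X) (t : ℕ) (p : Fin N) (a : Fin K) :
    μ[X t p a] = meanReward D p a := by
  rw [meanReward, ← h.law t p a]
  exact (integral_map (h.measurable t p a).aemeasurable aestronglyMeasurable_id).symm

theorem iIndepFun_sub (h : IsRewardProcess μ D X) (p : Fin N) (a : Fin K) :
    iIndepFun (fun t ω => X (t + 1) p a ω - meanReward D p a) μ :=
  ((h.indep p a).precomp (add_left_injective 1)).comp (fun _ x => x - meanReward D p a)
    fun _ => measurable_id.sub_const _

variable [IsProbabilityMeasure μ]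

theorem meanReward_mem_Icc (h : IsRewardProcess μ D X) (p : Fin N) (a : Fin K) :
    meanReward D p a ∈ Set.Icc (0 : ℝ) 1 := by
  rw [← h.integral_eq 0 p a]
  have hb := h.ae_mem_Icc 0 p a
  refine ⟨integral_nonneg_of_ae (hb.mono fun ω hω => hω.1), ?_⟩
  calc μ[X 0 p a] ≤ ∫ _, (1 : ℝ) ∂μ :=
        integral_mono_ae (Integrable.of_mem_Icc 0 1 (h.measurable 0 p a).aemeasurable hb)
          (integrable_const _) (hb.mono fun ω hω => hω.2)
    _ = 1 := by simp

/-- Hoeffding's lemma; 1/4 is the squared half-length of [0, 1]. -/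
theorem hasSubgaussianMGF (h : IsRewardProcess μ D X) (t : ℕ) (p : Fin N) (a : Fin K) :
    HasSubgaussianMGF (fun ω => X t p a ω - meanReward D p a) (1 / 4) μ := by
  have h1 := hasSubgaussianMGF_of_mem_Icc (h.measurable t p a).aemeasurable (h.ae_mem_Icc t p a)
  rw [h.integral_eq] at h1
  convert h1 using 1
  norm_num

/-- The radius is chosen so that each Hoeffding tail in round n = t + 1 is exactly δ / (4 K N n²);
the two tails together give the bound. -/
theorem measure_confRadius_lt_le (h : IsRewardProcess μ D X) {δ : ℝ} (hN : 1 ≤ N) (hK : 2 ≤ K)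
    (hδ : 0 < δ) (hδ1 : δ ≤ 1) (p : Fin N) (a : Fin K) (t : ℕ) :
    μ {ω | confRadius N K δ (t + 1) <
        |rewardAverage (fun t p a => X t p a ω) (t + 1) p a - meanReward D p a|} ≤
      ENNReal.ofReal (δ / (2 * K * N) * (1 / ((t + 1 : ℕ) : ℝ) ^ 2)) := by
  set n : ℕ := t + 1 with hn
  set ε := confRadius N K δ n
  have hn0 : (0 : ℝ) < n := by positivity
  have hn1 : (1 : ℝ) ≤ n := by exact_mod_cast Nat.succ_le_succ (Nat.zero_le t)
  have hN0 : (0 : ℝ) < N := by exact_mod_cast hN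
  have hK0 : (0 : ℝ) < K := by exact_mod_cast (by omega : 0 < K)
  have hε : 0 ≤ n * ε := mul_nonneg hn0.le (confRadius_nonneg _ _ _ _)
  have hc := eight_le_of_two_le hN hK hδ hδ1
  have hbig : 1 ≤ 4 * (K : ℝ) * N * (n : ℝ) ^ 2 / δ := by
    rw [mul_div_right_comm]
    nlinarith [one_le_pow₀ hn1 (n := 2)]
  have hexp : Real.exp (-(n * ε) ^ 2 / (2 * n * ((1 / 4 : NNReal) : ℝ))) =
      δ / (4 * K * N * n ^ 2) := by
    have h1 : ε ^ 2 = Real.log (4 * K * N * (n : ℝ) ^ 2 / δ) / (2 * n) :=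
      Real.sq_sqrt (div_nonneg (Real.log_nonneg hbig) (by positivity))
    have h2 : -(n * ε) ^ 2 / (2 * n * ((1 / 4 : NNReal) : ℝ)) =
        -Real.log (4 * K * N * (n : ℝ) ^ 2 / δ) := by
      rw [mul_pow, h1]
      push_cast
      field_simp
      ring_nf
    rw [h2, Real.exp_neg, Real.exp_log (by positivity), inv_div]
  have hup := HasSubgaussianMGF.measure_sum_range_ge_le_of_iIndepFun (h.iIndepFun_sub p a) (n := n)
    (fun i _ => h.hasSubgaussianMGF (i + 1) p a) hε
  have hlo := HasSubgaussianMGF.measure_sum_range_ge_le_of_iIndepFun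
    ((h.iIndepFun_sub p a).comp (fun _ x => -x) fun _ => measurable_neg) (n := n)
    (fun i _ => (h.hasSubgaussianMGF (i + 1) p a).neg) hε
  rw [hexp] at hup hlo
  have hsub : {ω | ε < |rewardAverage (fun t p a => X t p a ω) n p a - meanReward D p a|} ⊆
      {ω | n * ε ≤ ∑ i ∈ Finset.range n, (X (i + 1) p a ω - meanReward D p a)} ∪
      {ω | n * ε ≤ ∑ i ∈ Finset.range n,
        ((fun x => -x) ∘ fun ω => X (i + 1) p a ω - meanReward D p a) ω} := by
    intro ω hω
    simp only [Set.mem_ofPred_eq, Set.mem_union, Function.comp_apply, Finset.sum_neg_distrib,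
      Finset.sum_sub_distrib, Finset.sum_const, Finset.card_range, nsmul_eq_mul] at hω ⊢
    have e : ∑ i ∈ Finset.range n, X (i + 1) p a ω =
        n * rewardAverage (fun t p a => X t p a ω) n p a := by
      rw [rewardAverage]
      field_simp
    rw [e, ← mul_sub, ← mul_neg]
    rcases lt_abs.1 hω with h1 | h1
    · exact .inl (mul_le_mul_of_nonneg_left h1.le hn0.le)
    · exact .inr (mul_le_mul_of_nonneg_left h1.le hn0.le)
  rw [← ofReal_measureReal]
  refine ENNReal.ofReal_le_ofReal ?_
  calc _ ≤ _ := measureReal_mono hsub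
    _ ≤ _ := measureReal_union_le _ _
    _ ≤ δ / (4 * K * N * n ^ 2) + δ / (4 * K * N * n ^ 2) := add_le_add hup hlo
    _ = _ := by field_simp; norm_num

/-- Since ∑ 1/n² = π²/6 ≤ 2, each of the K N pairs fails in some round with probability at most δ /
(K N). -/
theorem measure_not_averagesAccurate_le (h : IsRewardProcess μ D X) {δ : ℝ} (hN : 1 ≤ N)
    (hK : 2 ≤ K) (hδ : 0 < δ) (hδ1 : δ ≤ 1) :
    μ {ω | ¬ AveragesAccurate δ (fun t p a => X t p a ω) (meanReward D)} ≤ ENNReal.ofReal δ := by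
  have hN0 : (0 : ℝ) < N := by exact_mod_cast hN
  have hK0 : (0 : ℝ) < K := by exact_mod_cast (by omega : 0 < K)
  have hsub : {ω | ¬ AveragesAccurate δ (fun t p a => X t p a ω) (meanReward D)} ⊆
      ⋃ x : MarketPair N K, ⋃ t : ℕ, {ω | confRadius N K δ (t + 1) <
        |rewardAverage (fun t p a => X t p a ω) (t + 1) x.1 x.2 - meanReward D x.1 x.2|} := by
    intro ω hω
    simp only [AveragesAccurate, Set.mem_ofPred_eq, not_forall, not_le] at hω
    obtain ⟨t, p, a, hω⟩ := hω
    exact Set.mem_iUnion.2 ⟨(p, a), Set.mem_iUnion.2 ⟨t, hω⟩⟩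
  calc _ ≤ _ := measure_mono hsub
    _ ≤ ∑ _x : MarketPair N K, ENNReal.ofReal (2 * (δ / (2 * K * N))) := by
        refine (measure_iUnion_fintype_le _ _).trans (Finset.sum_le_sum fun x _ => ?_)
        exact (measure_iUnion_le _).trans ((ENNReal.tsum_le_tsum fun t =>
          h.measure_confRadius_lt_le hN hK hδ hδ1 x.1 x.2 t).trans (tsum_ofReal_mul_one_div_sq_le (by positivity)))
    _ = ENNReal.ofReal δ := by
        rw [Finset.sum_const, nsmul_eq_mul, Finset.card_univ, Fintype.card_prod, Fintype.card_fin,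
          Fintype.card_fin, ← ENNReal.ofReal_natCast, ← ENNReal.ofReal_mul (by positivity)]
        congr 1
        push_cast
        field_simp

/-- Subadditivity applied to the bad event and `s` avoids any measurability of `s`. For δ ≥ 1 the
claim is empty. -/
theorem ofReal_one_sub_le (h : IsRewardProcess μ D X) {δ : ℝ} (hN : 1 ≤ N) (hK : 2 ≤ K)
    (hδ : 0 < δ) {s : Set Ω}
    (hs : δ ≤ 1 → ∀ ω, AveragesAccurate δ (fun t p a => X t p a ω) (meanReward D) → ω ∈ s) :
    ENNReal.ofReal (1 - δ) ≤ μ s := by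
  rcases le_total δ 1 with hδ1 | hδ1
  · rw [ENNReal.ofReal_sub _ hδ.le, ENNReal.ofReal_one, tsub_le_iff_left]
    calc (1 : ENNReal) = μ Set.univ := measure_univ.symm
      _ ≤ μ ({ω | ¬ AveragesAccurate δ (fun t p a => X t p a ω) (meanReward D)} ∪ s) := by
          refine measure_mono fun ω _ => ?_
          by_cases hω : AveragesAccurate δ (fun t p a => X t p a ω) (meanReward D)
          · exact .inr (hs hδ1 ω hω)
          · exact .inl hω
      _ ≤ _ := (measure_union_le _ _).trans
          (add_le_add_left (h.measure_not_averagesAccurate_le hN hK hδ hδ1) _)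
  · rw [ENNReal.ofReal_of_nonpos (by linarith)]
    exact zero_le

end IsRewardProcess

end Concentration

/-! ### The main theorem and its degenerate cases. -/

theorem theorem2 :
    ∃ C : ℝ, 0 < C ∧
      ∀ (N K : ℕ), N ≤ K →
      ∀ (ρ : Fin K → Equiv.Perm (Fin N))
        (cover : Finset (MarketPair N K) → Finset (Finset (MarketPair N K))),
        (∀ S, IsMinimalMatchingCover S (cover S)) →
      ∀ (Ω : Type*) [MeasurableSpace Ω] (μ : Measure Ω) [IsProbabilityMeasure μ]
        (D : Fin N → Fin K → Measure ℝ) (X : ℕ → Fin N → Fin K → Ω → ℝ),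
        IsRewardProcess μ D X →
        (∀ p, Function.Injective (meanReward D p)) →
      ∀ δ : ℝ, 0 < δ →
        ENNReal.ofReal (1 - δ) ≤
          μ {ω | ∃ T, (elimRun δ cover (fun t p a => X t p a ω) T).active = ∅ ∧
            IsPlayerOptimalStable (fun p => argsortDesc (meanReward D p)) ρ
              ((elimRun δ cover (fun t p a => X t p a ω) T).output ρ)} ∧
        (2 ≤ K →
          ∀ (tie : MarketPair N K → ℕ), Function.Injective tie →
          ∀ r : Fin K → Finset (MarketPair N K),
            IsDegreeReducingSequence (sampleBound δ (meanReward D)) tie r →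
            ENNReal.ofReal (1 - δ) ≤
              μ {ω | ∃ T, (elimRun δ cover (fun t p a => X t p a ω) T).active = ∅ ∧
                IsPlayerOptimalStable (fun p => argsortDesc (meanReward D p)) ρ
                  ((elimRun δ cover (fun t p a => X t p a ω) T).output ρ) ∧
                ((elimRun δ cover (fun t p a => X t p a ω) T).numMatchings : ℝ) ≤
                  C * ∑ s, sSup (sampleBound δ (meanReward D) '' (r s : Set (MarketPair N K)))}) := by
  refine ⟨258, by norm_num, fun N K hNK ρ cover hcover Ω _ μ _ D X hX hinj δ hδ => ⟨?_, ?_⟩⟩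
  · by_cases hK : 2 ≤ K ∧ 1 ≤ N
    · refine hX.ofReal_one_sub_le hK.2 hK.1 hδ fun hδ1 ω hω => ?_
      obtain ⟨T, h1, h2, -⟩ := elimRun_of_averagesAccurate hcover hK.2 hNK hK.1 hδ hδ1 hinj
        hX.meanReward_mem_Icc hω ρ
      exact ⟨T, h1, h2⟩
    -- With at most one arm or no player, one round empties the available set for every outcome, and
    -- there are no two arms to compare.
    · have hall (ω : Ω) : ∃ T, (elimRun δ cover (fun t p a => X t p a ω) T).active = ∅ ∧
          IsPlayerOptimalStable (fun p => argsortDesc (meanReward D p)) ρ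
            ((elimRun δ cover (fun t p a => X t p a ω) T).output ρ) := by
        refine ⟨1, ?_, isPlayerOptimalStable_output hinj ρ fun p a b hab => ?_⟩
        · by_cases hN : 1 ≤ N
          · exact active_eq_empty_of_le_one (by omega)
          · obtain rfl : N = 0 := by omega
            exact Finset.eq_empty_of_isEmpty _
        · have := p.2
          have := a.2
          have := b.2
          obtain rfl : a = b := Fin.ext (by omega)
          exact absurd hab (lt_irrefl _)
      rw [Set.eq_univ_of_forall (s := {ω | ∃ T, (elimRun δ cover _ T).active = ∅ ∧ _}) hall,
        measure_univ, ENNReal.ofReal_le_one]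
      linarith
  · intro hK tie htie r hr
    -- Without players there are no pairs, and the degree 0 of the empty set cannot be lowered, so
    -- no sequence `r` exists.
    have hN : 1 ≤ N := by
      by_contra! hN
      obtain rfl : N = 0 := by omega
      have h1 := (hr.mem ⟨0, by omega⟩).2
      rw [Finset.eq_empty_of_isEmpty (pairsAfter r _), maxDegree_empty] at h1
      omega
    refine hX.ofReal_one_sub_le hN hK hδ fun hδ1 ω hω => ?_
    obtain ⟨T, h1, h2, h3⟩ := elimRun_of_averagesAccurate hcover hN hNK hK hδ hδ1 hinj
      hX.meanReward_mem_Icc hω ρ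
    exact ⟨T, h1, h2, h3 tie htie r hr⟩
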